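/- Let $p\ge 3$ be a prime and let $$H_p=\left\{\begin{pmatrix}1&a&c\\0&1&b\\0&0&1\end{pmatrix} : a,b,c\in\mathbb Z/p\mathbb Z\right\}$$ be the Heisenberg group over $\mathbb Z/p\mathbb Z$, a group of order $p^3$ under matrix multiplication. For an element $F=\sum_{g\in H_p}a_g\,g$ of the group ring $\mathbb Z[H_p]$ let $$M_{H_p}(F)=\det\left(a_{gh^{-1}}\right)_{g,h\in H_p}\in\mathbb Z$$ be its integer group determinant. If $p\mid M_{H_p}(F)$, then $p^{p^2+3}\mid M_{H_p}(F)$. Moreover, there exists $F\in\mathbb Z[H_p]$ such that $p^{p^2+3}\parallel M_{H_p}(F)$, that is, $p^{p^2+3}\mid M_{H_p}(F)$ but $p^{p^2+4}\nmid M_{H_p}(F)$. -/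

import Mathlib

/-- The Heisenberg group over `R`: the group, under matrix multiplication, of all `3 × 3` matrices
`!![1, a, c; 0, 1, b; 0, 0, 1]` with `a, b, c ∈ R`. -/
def heisenbergGroup (R : Type*) [CommRing R] :
    Subgroup (Matrix.SpecialLinearGroup (Fin 3) R) where
  carrier := {g | ∃ a b c : R, (g : Matrix (Fin 3) (Fin 3) R) = !![1, a, c; 0, 1, b; 0, 0, 1]}
  one_mem' := ⟨0, 0, 0, by
    ext i j; fin_cases i <;> fin_cases j <;> simp⟩
  mul_mem' := by
    rintro g h ⟨a, b, c, hg⟩ ⟨a', b', c', hh⟩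
    refine ⟨a' + a, b' + b, c' + a * b' + c, ?_⟩
    rw [Matrix.SpecialLinearGroup.coe_mul, hg, hh]
    ext i j; fin_cases i <;> fin_cases j <;> simp [Matrix.mul_apply, Fin.sum_univ_three]
  inv_mem' := by
    rintro g ⟨a, b, c, hg⟩
    refine ⟨-a, -b, a * b - c, ?_⟩
    rw [Matrix.SpecialLinearGroup.coe_inv, hg, Matrix.adjugate_fin_three]
    ext i j; fin_cases i <;> fin_cases j <;> simp

noncomputable instance heisenbergGroup.instFintype (R : Type*) [CommRing R] [Finite R] :
    Fintype (heisenbergGroup R) :=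
  Fintype.ofFinite _

/-- The integer group determinant `M_G(F) = det (a_{g h⁻¹})`, rows indexed by `g` and columns
by `h`, of an element `F = ∑ a_g g` of the integral group ring `ℤ[G]` of a finite group `G`. -/
def groupDet {G : Type*} [Group G] [Fintype G] [DecidableEq G] (F : MonoidAlgebra ℤ G) : ℤ :=
  Matrix.det (Matrix.of fun g h : G => F.coeff (g * h⁻¹))

/-!
Let `π = 1 - ζ` in `ℤ[ζ]`, with `ζ` a primitive `p`-th root of unity, so that `p` is associated to
`π ^ (p - 1)`. Diagonalizing over the centre and `x` factors the group determinant into the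
determinants of the `p ^ 2` representations induced from the characters of the abelian subgroup
`b = 0`. In each of these determinants, translation permutes the terms of the full expansion up to
roots of unity, and modulo `p` only the translation-invariant terms survive; they add up to the
augmentation `∑ a_g`. Hence either no factor is divisible by `π`, or all of them are divisible by
`p`. The `p * (p - 1)` representations nontrivial on the centre then contribute `p ^ (p * (p - 1))`.
The others split into the linear characters: the trivial one contributes `p`, and each of the
remaining `p ^ 2 - 1` contributes `π`, or even `π ^ 2` for those at least `p - 1` characters that
are orthogonal to the first moment of the coefficients, which gives `(p - 1) * (p + 2)` factors `π`
and so `p ^ (p + 2)`.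

For sharpness take `y - (1 + (1 - x) ^ 2 + k * ∑ a, x ^ a)`. All its factors are explicit, and for
`k = 1` or `k = 2` none of them has a larger valuation than forced.
-/

open Finset Matrix MulAction

section Circulant

variable {V R : Type*} [AddCommGroup V] [Fintype V] [DecidableEq V] [CommRing R] [IsDomain R]

theorem det_addChar_neg_ne_zero {χ : V → AddChar V R} (hχ : Function.Injective χ) :
    (of fun v u : V => χ u (-v)).det ≠ 0 := by
  intro hdet
  obtain ⟨c, hc, hmul⟩ := exists_mulVec_eq_zero_iff.mpr hdet
  have hli : LinearIndependent R fun u => ⇑(χ u).toMonoidHom :=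
    (linearIndependent_monoidHom (Multiplicative V) R).comp (fun u => (χ u).toMonoidHom)
      (AddChar.toMonoidHomEquiv.injective.comp hχ)
  refine hc (funext (Fintype.linearIndependent_iff.mp hli c ?_))
  funext v
  simpa [mulVec, dotProduct, mul_comm] using congrFun hmul (-v.toAdd)

theorem det_block_circulant {ι : Type*} [Fintype ι] [DecidableEq ι]
    {χ : V → AddChar V R} (hχ : Function.Injective χ) (f : ι → ι → V → R) :
    (of fun x y : ι × V => f x.1 y.1 (x.2 - y.2)).det =
      ∏ u, (of fun i j => ∑ v, f i j v * χ u v).det := by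
  set P : Matrix V V R := of fun v u => χ u (-v) with hP
  set Q : Matrix (ι × V) (ι × V) R := kroneckerMap (· * ·) 1 P with hQ
  have hQdet : Q.det ≠ 0 := by
    rw [hQ, det_kronecker]
    simpa using pow_ne_zero _ (det_addChar_neg_ne_zero hχ)
  have hdiag : (of fun x y : ι × V => f x.1 y.1 (x.2 - y.2)) * Q =
      Q * blockDiagonal fun u => of fun i j => ∑ v, f i j v * χ u v := by
    ext ⟨i, v⟩ ⟨j, u⟩
    simp only [mul_apply, Fintype.sum_prod_type, hQ, kroneckerMap_apply, hP, of_apply,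
      blockDiagonal_apply, one_apply]
    rw [sum_eq_single j (by intro b _ hb; simp [hb]) (by simp),
      sum_eq_single i (by intro b _ hb; simp [hb.symm]) (by simp)]
    simp only [if_true, one_mul, mul_ite, mul_zero, sum_ite_eq', mem_univ, mul_sum]
    refine Fintype.sum_equiv (Equiv.subLeft v) _ _ fun w => ?_
    rw [mul_left_comm, ← AddChar.map_add_eq_mul, Equiv.subLeft_apply, neg_add_eq_sub,
      sub_sub_cancel_left]
  have hmul := congrArg det hdiag
  rw [det_mul, det_mul, mul_comm, det_blockDiagonal] at hmul
  exact mul_left_cancel₀ hQdet hmul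

theorem det_circulant_eq_prod {χ : V → AddChar V R} (hχ : Function.Injective χ) (f : V → R) :
    (circulant f).det = ∏ u, ∑ v, f v * χ u v := by
  have h := det_block_circulant (ι := Unit) hχ fun _ _ => f
  simp only [det_unique, of_apply] at h
  rw [← h, ← det_submatrix_equiv_self (Equiv.punitProd V)]
  rfl

end Circulant

section FixedPoints

variable {p : ℕ} [Fact p.Prime] {G X R : Type*} [Group G] [MulAction G X] [Fintype X]
  [DecidablePred (· ∈ fixedPoints G X)] [CommRing R]

theorem prime_dvd_sum_sub_sum_fixedPoints_of_invariant (hG : IsPGroup p G) {w : X → R}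
    (hw : ∀ (g : G) x, w (g • x) = w x) :
    (p : R) ∣ ∑ x, w x - ∑ x with x ∈ fixedPoints G X, w x := by
  classical
  rw [← sum_filter_add_sum_filter_not univ (· ∈ fixedPoints G X), add_sub_cancel_left,
    sum_comp (fun v => v) w]
  refine dvd_sum fun v _ => ?_
  let N : SubMulAction G X :=
    { carrier := {x | x ∉ fixedPoints G X ∧ w x = v}
      smul_mem' := fun g x hx => ⟨fun hgx => hx.1 ?_, (hw g x).trans hx.2⟩ }
  · have hN : fixedPoints G N = ∅ := Set.eq_empty_of_forall_notMem fun x hx =>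
      x.2.1 fun g => congrArg Subtype.val (hx g)
    have hcard : p ∣ Nat.card N := by
      simpa [hN, Nat.modEq_zero_iff_dvd] using hG.card_modEq_card_fixedPoints N
    have hfilter : #{x ∈ ({x | x ∉ fixedPoints G X} : Finset X) | w x = v} = Nat.card N := by
      rw [filter_filter, ← Fintype.card_subtype, ← Nat.card_eq_fintype_card]
      rfl
    rw [nsmul_eq_mul, hfilter]
    exact (Nat.cast_dvd_cast hcard).mul_right _
  · have hx : x = g • x := by simpa using hgx g⁻¹
    rwa [hx]

theorem prime_dvd_sum_sub_sum_fixedPoints [IsDomain R] (hG : IsPGroup p G) {w : X → R}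
    (χ : X → G →* R) (hχ : ∀ (g : G) x, χ (g • x) = χ x)
    (hw : ∀ (g : G) x, w (g • x) = χ x g * w x) :
    (p : R) ∣ ∑ x, w x - ∑ x with x ∈ fixedPoints G X, w x := by
  classical
  have hfiber : ∀ θ : G →* R, θ ≠ 1 → ∑ x with χ x = θ, w x = 0 := by
    intro θ hθ
    obtain ⟨g, hg⟩ := DFunLike.ne_iff.mp hθ
    have hsum : ∑ x with χ x = θ, w x = θ g * ∑ x with χ x = θ, w x := by
      simp only [sum_filter, mul_sum]
      rw [← Equiv.sum_comp (toPerm g)]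
      refine sum_congr rfl fun x _ => ?_
      simp only [toPerm_apply, hχ, hw, mul_ite, mul_zero]
      exact if_ctx_congr Iff.rfl (fun h => by rw [h]) fun _ => rfl
    exact (mul_left_eq_self₀.mp hsum.symm).resolve_left hg
  have htotal : ∑ x, w x = ∑ x, if χ x = 1 then w x else 0 := by
    rw [← sum_filter, ← sum_fiberwise_of_maps_to (t := insert 1 (univ.image χ)) (g := χ) (by simp)]
    exact sum_eq_single_of_mem 1 (mem_insert_self _ _) fun θ _ hθ => hfiber θ hθ
  have hfixed : ∀ x ∈ fixedPoints G X, w x = if χ x = 1 then w x else 0 := by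
    intro x hx
    refine (ite_eq_left_iff.mpr fun hne => ?_).symm
    obtain ⟨g, hg⟩ := DFunLike.ne_iff.mp hne
    exact ((mul_left_eq_self₀.mp ((hw g x).symm.trans (congrArg w (hx g)))).resolve_left hg).symm
  rw [htotal, sum_congr rfl fun x hx => hfixed x (mem_filter.mp hx).2]
  refine prime_dvd_sum_sub_sum_fixedPoints_of_invariant hG fun g x => ?_
  rw [hχ, hw]
  split_ifs with h
  · rw [h, MonoidHom.one_apply, one_mul]
  · rfl

end FixedPoints

section TwistedCirculant

section OddOrder

variable {A : Type*} [AddCommGroup A] [Fintype A]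

theorem sign_addRight_eq_one_of_odd_card [DecidableEq A] (hA : Odd (Fintype.card A)) (b : A) :
    Equiv.Perm.sign (Equiv.addRight b) = 1 := by
  have hpow : Equiv.addRight b ^ Fintype.card A = 1 := by
    ext x
    simp
  rw [← pow_one (Equiv.Perm.sign _), ← Nat.odd_iff.mp hA, ← Int.units_pow_eq_pow_mod_two,
    ← map_pow, hpow, map_one]

theorem sum_univ_eq_zero_of_odd_card (hA : Odd (Fintype.card A)) : ∑ b : A, b = 0 := by
  obtain ⟨k, hk⟩ := hA
  have hneg : -∑ b : A, b = ∑ b : A, b := by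
    rw [← sum_neg_distrib]
    exact Equiv.sum_comp (Equiv.neg A) id
  have htwo : 2 • ∑ b : A, b = 0 := by rw [two_nsmul, neg_eq_iff_add_eq_zero.mp hneg]
  calc ∑ b : A, b = Fintype.card A • ∑ b : A, b := by
        rw [hk, add_nsmul, mul_nsmul, htwo, nsmul_zero, zero_add, one_nsmul]
    _ = 0 := card_nsmul_eq_zero

end OddOrder

/-- The translations of `A`, acting on a permutation by conjugation and on a self-map by
precomposition. The pairs acted on index the terms of the determinant of a twisted circulant. -/
@[reducible]
def translationAction (A : Type*) [AddCommGroup A] :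
    MulAction (Multiplicative A) (Equiv.Perm A × (A → A)) where
  smul t x := ((Equiv.addRight t.toAdd).permCongr x.1, fun b => x.2 (b - t.toAdd))
  one_smul x := Prod.ext (Equiv.ext fun b => by simp [HSMul.hSMul]) (by simp [HSMul.hSMul])
  mul_smul s t x := by
    refine Prod.ext (Equiv.ext fun b => ?_) (funext fun b => ?_)
    · simp [HSMul.hSMul, add_comm s.toAdd, add_assoc]
    · simp [HSMul.hSMul, sub_sub]

attribute [local instance] translationAction

theorem translationAction_smul_eq {A : Type*} [AddCommGroup A] (t : Multiplicative A)
    (x : Equiv.Perm A × (A → A)) :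
    t • x = ((Equiv.addRight t.toAdd).permCongr x.1, fun b => x.2 (b - t.toAdd)) :=
  rfl

theorem mem_fixedPoints_translationAction {A : Type*} [AddCommGroup A]
    {x : Equiv.Perm A × (A → A)} :
    x ∈ fixedPoints (Multiplicative A) (Equiv.Perm A × (A → A)) ↔
      ∃ β a, x = (Equiv.addRight β, Function.const A a) := by
  constructor
  · intro hx
    refine ⟨x.1 0, x.2 0, Prod.ext (Equiv.ext fun b => ?_) (funext fun b => ?_)⟩
    · have h := DFunLike.congr_fun (congrArg Prod.fst (hx (.ofAdd b))) b
      simpa [translationAction_smul_eq, add_comm] using h.symm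
    · have h := congrFun (congrArg Prod.snd (hx (.ofAdd b))) b
      simpa [translationAction_smul_eq] using h.symm
  · rintro ⟨β, a, rfl⟩ t
    refine Prod.ext (Equiv.ext fun b => ?_) rfl
    simp [translationAction_smul_eq, add_assoc]

variable {A R : Type*} [CommRing A] [Fintype A] [DecidableEq A] [CommRing R]

theorem addChar_map_sum {ι B M : Type*} [AddCommMonoid B] [CommMonoid M] (ψ : AddChar B M)
    (s : Finset ι) (f : ι → B) : ψ (∑ i ∈ s, f i) = ∏ i ∈ s, ψ (f i) :=
  map_prod ψ.toMonoidHom (fun i => Multiplicative.ofAdd (f i)) s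

/-- The matrix with `(i, j)` entry `∑ a, φ (i - j) a * ψ (a * j)`: a circulant matrix whose columns
are twisted by the translates of the character `ψ`. -/
def twistedCirculant (ψ : AddChar A R) (φ : A → A → R) : Matrix A A R :=
  of fun i j => ∑ a, φ (i - j) a * ψ (a * j)

/-- The term of the fully expanded determinant of `twistedCirculant ψ φ` in which column `b`
contributes its entry in row `x.1 b`, and that entry its summand of index `x.2 b`. -/
def twistedWeight (ψ : AddChar A R) (φ : A → A → R) (x : Equiv.Perm A × (A → A)) : R :=
  ((Equiv.Perm.sign x.1 : ℤ) : R) * ∏ b, φ (x.1 b - b) (x.2 b) * ψ (x.2 b * b)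

theorem det_twistedCirculant_eq_sum (ψ : AddChar A R) (φ : A → A → R) :
    (twistedCirculant ψ φ).det = ∑ x, twistedWeight ψ φ x := by
  rw [det_apply', Fintype.sum_prod_type]
  refine sum_congr rfl fun σ _ => ?_
  simp only [twistedCirculant, of_apply, twistedWeight, prod_univ_sum, mul_sum,
    Fintype.piFinset_univ]

theorem twistedWeight_smul (ψ : AddChar A R) (φ : A → A → R) (t : Multiplicative A)
    (x : Equiv.Perm A × (A → A)) :
    twistedWeight ψ φ (t • x) = ψ ((∑ b, x.2 b) * t.toAdd) * twistedWeight ψ φ x := by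
  simp only [twistedWeight, translationAction_smul_eq, Equiv.Perm.sign_permCongr]
  rw [mul_left_comm, ← Equiv.prod_comp (Equiv.addRight t.toAdd), sum_mul, addChar_map_sum,
    ← prod_mul_distrib]
  congr 1
  refine prod_congr rfl fun b _ => ?_
  simp only [Equiv.permCongr_apply, Equiv.addRight_symm, Equiv.coe_addRight,
    add_neg_cancel_right, add_sub_cancel_right, add_sub_add_right_eq_sub, mul_add,
    AddChar.map_add_eq_mul]
  ring

theorem twistedWeight_addRight_const (hA : Odd (Fintype.card A)) (ψ : AddChar A R)
    (φ : A → A → R) (β a : A) :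
    twistedWeight ψ φ (Equiv.addRight β, Function.const A a) = φ β a ^ Fintype.card A := by
  have hψ : ∏ b, ψ (a * b) = 1 := by
    rw [← addChar_map_sum, ← mul_sum, sum_univ_eq_zero_of_odd_card hA, mul_zero,
      AddChar.map_zero_eq_one]
  simp [twistedWeight, sign_addRight_eq_one_of_odd_card hA, prod_mul_distrib, hψ]

theorem prime_dvd_det_twistedCirculant_sub_sum [IsDomain R] {p : ℕ} [Fact p.Prime]
    (hp : IsPGroup p (Multiplicative A)) (hA : Odd (Fintype.card A)) (ψ : AddChar A R)
    (φ : A → A → R) :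
    (p : R) ∣ (twistedCirculant ψ φ).det - ∑ β, ∑ a, φ β a ^ Fintype.card A := by
  classical
  have hfixed : ∑ x with x ∈ fixedPoints (Multiplicative A) (Equiv.Perm A × (A → A)),
      twistedWeight ψ φ x = ∑ β, ∑ a, φ β a ^ Fintype.card A := by
    rw [← Fintype.sum_prod_type']
    refine sum_nbij' (fun x => (x.1 0, x.2 0))
      (fun y => (Equiv.addRight y.1, Function.const A y.2)) (by simp) ?_ ?_ (by simp) ?_
    · exact fun y _ => mem_filter.mpr
        ⟨mem_univ _, mem_fixedPoints_translationAction.mpr ⟨y.1, y.2, rfl⟩⟩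
    all_goals
      intro x hx
      obtain ⟨β, a, rfl⟩ := mem_fixedPoints_translationAction.mp (mem_filter.mp hx).2
      simp [twistedWeight_addRight_const hA]
  rw [det_twistedCirculant_eq_sum, ← hfixed]
  refine prime_dvd_sum_sub_sum_fixedPoints hp
    (fun x => (ψ.mulShift (∑ b, x.2 b)).toMonoidHom) (fun t x => ?_) (twistedWeight_smul ψ φ)
  exact congrArg (fun s => (ψ.mulShift s).toMonoidHom)
    (Equiv.sum_comp (Equiv.subRight t.toAdd) x.2)

end TwistedCirculant

section Heisenberg

namespace heisenbergGroup

/-- The element of the Heisenberg group with entries `a`, `b` next to the diagonal and `c` in the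
corner. -/
def mk {A : Type*} [CommRing A] (a b c : A) : heisenbergGroup A :=
  ⟨⟨!![1, a, c; 0, 1, b; 0, 0, 1], by simp [det_fin_three]⟩, ⟨a, b, c, rfl⟩⟩

theorem mk_mul_mk {A : Type*} [CommRing A] (a b c a' b' c' : A) :
    mk a b c * mk a' b' c' = mk (a' + a) (b' + b) (c' + a * b' + c) := by
  apply Subtype.ext
  apply Subtype.ext
  rw [Subgroup.coe_mul, Matrix.SpecialLinearGroup.coe_mul]
  simp only [mk]
  ext i j
  fin_cases i <;> fin_cases j <;> simp [mul_apply, Fin.sum_univ_three]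

theorem mk_mul_inv_mk {A : Type*} [CommRing A] (a b c a' b' c' : A) :
    mk a b c * (mk a' b' c')⁻¹ = mk (a - a') (b - b') (c - c' - (a - a') * b') := by
  rw [mul_inv_eq_iff_eq_mul, mk_mul_mk]
  congr 1 <;> ring

/-- The coordinates `(b, (a, c))` on the Heisenberg group, which separate the quotient by the
abelian normal subgroup `b = 0` from that subgroup. -/
def coordEquiv (A : Type*) [CommRing A] : A × (A × A) ≃ heisenbergGroup A where
  toFun x := mk x.2.1 x.1 x.2.2
  invFun g := (g.1.1 1 2, (g.1.1 0 1, g.1.1 0 2))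
  left_inv x := by simp [mk]
  right_inv g := by
    obtain ⟨g, a, b, c, h⟩ := g
    exact Subtype.ext (Subtype.ext (by simp [mk, h]))

theorem mk_inj {A : Type*} [CommRing A] {a b c a' b' c' : A} :
    mk a b c = mk a' b' c' ↔ a = a' ∧ b = b' ∧ c = c' := by
  rw [← (coordEquiv A).symm.injective.eq_iff]
  simp [coordEquiv, mk, and_left_comm]

theorem sum_eq_sum_mk {A M : Type*} [CommRing A] [Fintype A] [AddCommMonoid M]
    (f : heisenbergGroup A → M) : ∑ g, f g = ∑ b, ∑ a, ∑ c, f (mk a b c) := by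
  simp only [← (coordEquiv A).sum_comp, Fintype.sum_prod_type]
  rfl

end heisenbergGroup

open heisenbergGroup

variable {A R : Type*} [CommRing A] [CommRing R]

/-- The character `(a, c) ↦ ψ (u.1 * a + u.2 * c)` of `A × A`. -/
def pairingChar (ψ : AddChar A R) (u : A × A) : AddChar (A × A) R :=
  ψ.compAddMonoidHom ((AddMonoidHom.mulLeft u.1).coprod (AddMonoidHom.mulLeft u.2))

theorem pairingChar_apply (ψ : AddChar A R) (u v : A × A) :
    pairingChar ψ u v = ψ (u.1 * v.1 + u.2 * v.2) :=
  rfl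

theorem pairingChar_injective {ψ : AddChar A R} (hψ : ψ.IsPrimitive) :
    Function.Injective (pairingChar ψ) := by
  intro u v h
  have hfst : ψ.mulShift u.1 = ψ.mulShift v.1 := by
    ext a
    simpa [pairingChar_apply] using DFunLike.congr_fun h (a, 0)
  have hsnd : ψ.mulShift u.2 = ψ.mulShift v.2 := by
    ext c
    simpa [pairingChar_apply] using DFunLike.congr_fun h (0, c)
  exact Prod.ext (AddChar.to_mulShift_inj_of_isPrimitive hψ hfst)
    (AddChar.to_mulShift_inj_of_isPrimitive hψ hsnd)

variable [Fintype A]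

/-- The matrix of `F` in the representation of the Heisenberg group induced from the character
`(a, c) ↦ ψ (u.1 * a + u.2 * c)` of the abelian normal subgroup `b = 0`. -/
def inducedMatrix (ψ : AddChar A R) (u : A × A) (F : MonoidAlgebra ℤ (heisenbergGroup A)) :
    Matrix A A R :=
  of fun i j => ∑ a, ∑ c, (F.coeff (mk a (i - j) c) : R) * ψ (u.1 * a + u.2 * (c + a * j))

theorem prime_dvd_sum_addChar_pow_card_sub {ι B : Type*} [AddCommGroup B] [Fintype B] {p : ℕ}
    [Fact p.Prime] (hB : IsPGroup p (Multiplicative B)) (ψ : AddChar B R) (s : Finset ι)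
    (m : ι → ℤ) (v : ι → B) :
    (p : R) ∣ (∑ i ∈ s, (m i : R) * ψ (v i)) ^ Fintype.card B - ((∑ i ∈ s, m i : ℤ) : R) := by
  by_cases hunit : IsUnit (p : R)
  · exact hunit.dvd
  have := CharP.quotient R p hunit
  obtain ⟨n, hn⟩ := IsPGroup.iff_card.mp hB
  have hcard : Fintype.card B = p ^ n := by
    rw [← hn, Nat.card_eq_fintype_card, Fintype.card_multiplicative]
  have hroot : ∀ b, ψ b ^ p ^ n = 1 := fun b => by
    rw [← AddChar.map_nsmul_eq_pow, ← hcard, card_nsmul_eq_zero, AddChar.map_zero_eq_one]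
  rw [← Ideal.mem_span_singleton, ← Ideal.Quotient.eq, map_pow, hcard,
    ← iterateFrobenius_def p n]
  simp only [map_sum, map_mul, map_intCast, iterateFrobenius_def, Int.cast_sum]
  simp only [← map_pow, hroot, map_one, mul_one]

/-- The coefficients of the image of `F` in the group ring of the abelianization `A × A`. -/
def abelianCoeff (F : MonoidAlgebra ℤ (heisenbergGroup A)) (v : A × A) : ℤ :=
  ∑ c, F.coeff (mk v.1 v.2 c)

theorem sum_abelianCoeff (F : MonoidAlgebra ℤ (heisenbergGroup A)) :
    ∑ v, abelianCoeff F v = ∑ g, F.coeff g := by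
  rw [sum_eq_sum_mk, Fintype.sum_prod_type_right]
  rfl

variable [DecidableEq A] [IsDomain R]

theorem prime_dvd_det_inducedMatrix_sub {p : ℕ} [Fact p.Prime]
    (hp : IsPGroup p (Multiplicative A)) (hA : Odd (Fintype.card A)) (ψ : AddChar A R)
    (u : A × A) (F : MonoidAlgebra ℤ (heisenbergGroup A)) :
    (p : R) ∣ (inducedMatrix ψ u F).det - ((∑ g, F.coeff g : ℤ) : R) := by
  let φ : A → A → R := fun b a => ∑ c, (F.coeff (mk a b c) : R) * ψ (u.1 * a + u.2 * c)
  have hmatrix : inducedMatrix ψ u F = twistedCirculant (ψ.mulShift u.2) φ := by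
    ext i j
    simp only [inducedMatrix, twistedCirculant, of_apply, φ, sum_mul, AddChar.mulShift_apply,
      mul_assoc, ← AddChar.map_add_eq_mul, mul_add, add_assoc]
  have hsum : ((∑ g, F.coeff g : ℤ) : R) =
      ∑ b, ∑ a, ((∑ c, F.coeff (mk a b c) : ℤ) : R) := by
    rw [sum_eq_sum_mk]
    push_cast
    rfl
  rw [hmatrix, hsum, ← sub_add_sub_cancel, ← sum_sub_distrib]
  refine dvd_add (prime_dvd_det_twistedCirculant_sub_sum hp hA _ φ) (dvd_sum fun b _ => ?_)
  rw [← sum_sub_distrib]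
  exact dvd_sum fun a _ => prime_dvd_sum_addChar_pow_card_sub hp ψ univ _ _

theorem cast_groupDet_eq_prod [DecidableEq (heisenbergGroup A)] {ψ : AddChar A R}
    (hψ : ψ.IsPrimitive) (F : MonoidAlgebra ℤ (heisenbergGroup A)) :
    (groupDet F : R) = ∏ u, (inducedMatrix ψ u F).det := by
  have hblock := det_block_circulant (pairingChar_injective hψ)
    fun i j v => (F.coeff (mk v.1 (i - j) (v.2 - v.1 * j)) : R)
  rw [groupDet, ← det_submatrix_equiv_self (coordEquiv A), Int.cast_det]
  refine Eq.trans (congrArg det ?_) (hblock.trans ?_)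
  · ext x y
    simp [coordEquiv, mk_mul_inv_mk]
  · refine prod_congr rfl fun u _ => congrArg det ?_
    ext i j
    simp only [inducedMatrix, of_apply, pairingChar_apply, Fintype.sum_prod_type]
    refine sum_congr rfl fun a _ => ?_
    exact Fintype.sum_equiv (Equiv.subRight (a * j)) _ _ fun c => by simp

theorem det_inducedMatrix_snd_zero {ψ : AddChar A R} (hψ : ψ.IsPrimitive) (s : A)
    (F : MonoidAlgebra ℤ (heisenbergGroup A)) :
    (inducedMatrix ψ (s, 0) F).det =
      ∏ r, ∑ v, (abelianCoeff F v : R) * ψ (s * v.1 + r * v.2) := by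
  have hcirculant := det_circulant_eq_prod (AddChar.to_mulShift_inj_of_isPrimitive hψ)
    fun b => ∑ a, (abelianCoeff F (a, b) : R) * ψ (s * a)
  refine Eq.trans (congrArg det ?_) (hcirculant.trans (prod_congr rfl fun r _ => ?_))
  · ext i j
    simp [inducedMatrix, abelianCoeff, sum_mul]
  · rw [Fintype.sum_prod_type_right]
    simp only [sum_mul, AddChar.mulShift_apply, AddChar.map_add_eq_mul, mul_assoc]

end Heisenberg

section CyclotomicPrime

variable {p : ℕ} [Fact p.Prime] {R : Type*} [CommRing R] {ψ : AddChar (ZMod p) R}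

theorem one_sub_addChar_dvd (ψ : AddChar (ZMod p) R) (s t : ZMod p) :
    1 - ψ s ∣ 1 - ψ (t * s) := by
  have hpow : ψ (t * s) = ψ s ^ t.val := by
    rw [← AddChar.map_nsmul_eq_pow, nsmul_eq_mul, ZMod.natCast_zmod_val]
  rw [hpow]
  exact one_sub_dvd_one_sub_pow _ _

theorem one_sub_addChar_one_dvd (ψ : AddChar (ZMod p) R) (s : ZMod p) : 1 - ψ 1 ∣ 1 - ψ s := by
  simpa using one_sub_addChar_dvd ψ 1 s

theorem one_sub_addChar_one_sq_dvd (ψ : AddChar (ZMod p) R) (s : ZMod p) :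
    (1 - ψ 1) ^ 2 ∣ ψ s - 1 + s.val * (1 - ψ 1) := by
  obtain ⟨x, hx⟩ := Polynomial.powAddExpansion 1 (ψ 1 - 1) s.val
  have hpow : ψ s = ψ 1 ^ s.val := by
    rw [← AddChar.map_nsmul_eq_pow, nsmul_one, ZMod.natCast_zmod_val]
  refine ⟨x, ?_⟩
  rw [add_sub_cancel, one_pow, one_pow, mul_one] at hx
  rw [hpow, hx]
  ring

theorem isPrimitive_of_prime_one_sub (hπ : Prime (1 - ψ 1)) : ψ.IsPrimitive :=
  AddChar.IsPrimitive.of_ne_one fun h => hπ.ne_zero (by simp [h])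

theorem isPrimitiveRoot_addChar_one (hψ : ψ.IsPrimitive) : IsPrimitiveRoot (ψ 1) p := by
  rw [IsPrimitiveRoot.iff_orderOf]
  refine orderOf_eq_prime ?_ ((AddChar.zmod_char_ne_one_iff p ψ).mp ?_)
  · rw [← AddChar.map_nsmul_eq_pow, nsmul_one, ZMod.natCast_self, AddChar.map_zero_eq_one]
  · simpa using hψ one_ne_zero

variable [IsDomain R]

theorem card_compl_zero_zmod : #({0}ᶜ : Finset (ZMod p)) = p - 1 := by
  rw [card_compl, card_singleton, ZMod.card]

theorem prod_one_sub_addChar (hψ : ψ.IsPrimitive) : ∏ s ∈ {0}ᶜ, (1 - ψ s) = p := by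
  obtain ⟨n, rfl⟩ : ∃ n, p = n + 1 := ⟨p - 1, (Nat.succ_pred_prime Fact.out).symm⟩
  have hprod := (isPrimitiveRoot_addChar_one hψ).prod_one_sub_pow_eq_order
  rw [Nat.cast_succ, ← hprod]
  change ∏ s ∈ ({0}ᶜ : Finset (Fin (n + 1))), (1 - ψ s) = _
  rw [← Fin.image_succ_univ, prod_image (Fin.succ_injective n).injOn, prod_range]
  refine prod_congr rfl fun i _ => ?_
  rw [← AddChar.map_nsmul_eq_pow, nsmul_one]
  congr 2
  exact (ZMod.natCast_zmod_val (n := n + 1) i.succ).symm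

theorem associated_one_sub_addChar {s : ZMod p} (hs : s ≠ 0) :
    Associated (1 - ψ s) (1 - ψ 1) :=
  associated_of_dvd_dvd (by simpa [hs] using one_sub_addChar_dvd ψ s s⁻¹)
    (one_sub_addChar_one_dvd ψ s)

theorem associated_natCast_prime (hψ : ψ.IsPrimitive) :
    Associated (p : R) ((1 - ψ 1) ^ (p - 1)) := by
  rw [← prod_one_sub_addChar hψ, ← card_compl_zero_zmod, ← prod_const]
  exact Associated.prod _ _ _ fun s hs => associated_one_sub_addChar (by simpa using hs)

theorem one_sub_addChar_one_sq_dvd_prime (hp : 3 ≤ p) (hψ : ψ.IsPrimitive) :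
    (1 - ψ 1) ^ 2 ∣ (p : R) :=
  (pow_dvd_pow _ (by omega)).trans (associated_natCast_prime hψ).symm.dvd

theorem one_sub_addChar_one_dvd_prime (hψ : ψ.IsPrimitive) : 1 - ψ 1 ∣ (p : R) :=
  (dvd_pow_self _ (Nat.sub_ne_zero_of_lt (Fact.out : p.Prime).one_lt)).trans
    (associated_natCast_prime hψ).symm.dvd

theorem prime_dvd_of_one_sub_addChar_dvd_intCast (hπ : Prime (1 - ψ 1)) {n : ℤ}
    (hn : 1 - ψ 1 ∣ (n : R)) : (p : ℤ) ∣ n := by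
  by_contra hdvd
  obtain ⟨a, b, hab⟩ := (Nat.prime_iff_prime_int.mp Fact.out).coprime_iff_not_dvd.mpr hdvd
  have hcast : (a : R) * p + b * n = 1 := by exact_mod_cast congrArg (Int.cast (R := R)) hab
  have hπp := one_sub_addChar_one_dvd_prime (isPrimitive_of_prime_one_sub hπ)
  exact hπ.not_dvd_one ((dvd_add (hπp.mul_left _) (hn.mul_left _)).trans hcast.dvd)

theorem prime_pow_dvd_of_natCast_pow_dvd_intCast (hπ : Prime (1 - ψ 1)) {n : ℕ} {b : ℤ}
    (hb : (p : R) ^ n ∣ (b : R)) : (p : ℤ) ^ n ∣ b := by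
  have hψ := isPrimitive_of_prime_one_sub hπ
  have hp : (p : R) ≠ 0 :=
    (associated_natCast_prime hψ).symm.ne_zero_iff.mp (pow_ne_zero _ hπ.ne_zero)
  induction n generalizing b with
  | zero => simp
  | succ n ih =>
    obtain ⟨c, rfl⟩ := prime_dvd_of_one_sub_addChar_dvd_intCast hπ <|
      (one_sub_addChar_one_dvd_prime hψ).trans ((dvd_pow_self _ n.succ_ne_zero).trans hb)
    rw [pow_succ'] at hb ⊢
    push_cast at hb
    exact mul_dvd_mul_left _ (ih ((mul_dvd_mul_iff_left hp).mp hb))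

end CyclotomicPrime

section LinearCharacters

variable {p : ℕ} [Fact p.Prime] {R : Type*} [CommRing R] {ψ : AddChar (ZMod p) R}
  {V : Type*} [Fintype V]

theorem one_sub_addChar_one_dvd_sum_sub (ψ : AddChar (ZMod p) R) (g : V → ℤ) (ℓ : V → ZMod p) :
    1 - ψ 1 ∣ ∑ v, (g v : R) * ψ (ℓ v) - ((∑ v, g v : ℤ) : R) := by
  rw [Int.cast_sum, ← sum_sub_distrib]
  refine dvd_sum fun v _ => ?_
  rw [← mul_sub_one]
  exact ((dvd_sub_comm).mp (one_sub_addChar_one_dvd ψ (ℓ v))).mul_left _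

variable [IsDomain R]

theorem one_sub_addChar_one_sq_dvd_sum_sub (hp : 3 ≤ p) (hψ : ψ.IsPrimitive) (g : V → ℤ)
    (ℓ : V → ZMod p) (hℓ : ∑ v, (g v : ZMod p) * ℓ v = 0) :
    (1 - ψ 1) ^ 2 ∣ ∑ v, (g v : R) * ψ (ℓ v) - ((∑ v, g v : ℤ) : R) := by
  have hmoment : (p : ℤ) ∣ ∑ v, g v * (ℓ v).val := by
    rw [← ZMod.intCast_zmod_eq_zero_iff_dvd, ← hℓ]
    simp
  have hfirst : (1 - ψ 1) ^ 2 ∣ ((∑ v, g v * (ℓ v).val : ℤ) : R) :=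
    (one_sub_addChar_one_sq_dvd_prime hp hψ).trans
      (by simpa using Int.cast_dvd_cast (α := R) _ _ hmoment)
  rw [← dvd_add_left (hfirst.mul_right (1 - ψ 1))]
  push_cast
  rw [sum_mul, ← sum_sub_distrib, ← sum_add_distrib]
  refine dvd_sum fun v _ => ?_
  convert (one_sub_addChar_one_sq_dvd ψ (ℓ v)).mul_left (g v : R) using 1
  ring

theorem pred_card_le_card_orthogonal {K : Type*} [Field K] [Fintype K] [DecidableEq K] (a b : K) :
    Fintype.card K - 1 ≤ #{u ∈ ({0}ᶜ : Finset (K × K)) | u.1 * a + u.2 * b = 0} := by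
  obtain ⟨v, hv, hortho⟩ : ∃ v : K × K, v ≠ 0 ∧ v.1 * a + v.2 * b = 0 := by
    by_cases hab : a = 0 ∧ b = 0
    · exact ⟨(0, 1), by simp, by simp [hab]⟩
    · exact ⟨(b, -a), by simpa [Prod.ext_iff, and_comm] using hab, by ring⟩
  calc Fintype.card K - 1 = #({0}ᶜ : Finset K) := by rw [card_compl, card_singleton]
    _ ≤ _ := card_le_card_of_injOn (· • v) (fun t ht => ?_) (smul_left_injective K hv).injOn
  have ht : t ≠ 0 := by simpa using ht
  simp only [coe_filter, mem_compl, mem_singleton, Set.mem_ofPred_eq, Prod.smul_fst, Prod.smul_snd,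
    smul_eq_mul]
  exact ⟨smul_ne_zero ht hv, by linear_combination t * hortho⟩

theorem pred_card_mul_le_sum_ite {K : Type*} [Field K] [Fintype K] [DecidableEq K] (a b : K) :
    (Fintype.card K - 1) * (Fintype.card K + 2) ≤
      ∑ u ∈ ({0}ᶜ : Finset (K × K)), if u.1 * a + u.2 * b = 0 then 2 else 1 := by
  have hsplit : ∀ u : K × K, (if u.1 * a + u.2 * b = 0 then 2 else 1) =
      1 + if u.1 * a + u.2 * b = 0 then 1 else 0 := fun u => by split_ifs <;> rfl
  obtain ⟨n, hn⟩ := Nat.exists_eq_add_one_of_ne_zero (Fintype.card_ne_zero (α := K))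
  have hortho := pred_card_le_card_orthogonal a b
  simp only [hsplit, sum_add_distrib, sum_const, sum_boole, card_compl, card_singleton,
    Fintype.card_prod, smul_eq_mul, mul_one, Nat.cast_id, hn,
    Nat.add_sub_cancel] at hortho ⊢
  have hsq : (n + 1) * (n + 1) - 1 = n * (n + 2) := Nat.sub_eq_of_eq_add (by ring)
  rw [hsq]
  linarith

theorem prime_pow_dvd_prod_sum_addChar (hp : 3 ≤ p) (hψ : ψ.IsPrimitive)
    (g : ZMod p × ZMod p → ℤ) (hg : (p : ℤ) ∣ ∑ v, g v) :
    (p : R) ^ (p + 3) ∣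
      ∏ u : ZMod p × ZMod p, ∑ v, (g v : R) * ψ (u.1 * v.1 + u.2 * v.2) := by
  set a := ∑ v, (g v : ZMod p) * v.1
  set b := ∑ v, (g v : ZMod p) * v.2
  have hgR : (p : R) ∣ ((∑ v, g v : ℤ) : R) := by simpa using Int.cast_dvd_cast (α := R) _ _ hg
  have hsq := (one_sub_addChar_one_sq_dvd_prime hp hψ).trans hgR
  have hfactor : ∀ u : ZMod p × ZMod p,
      (1 - ψ 1) ^ (if u.1 * a + u.2 * b = 0 then 2 else 1) ∣
        ∑ v, (g v : R) * ψ (u.1 * v.1 + u.2 * v.2) := by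
    intro u
    split_ifs with hu
    · refine (dvd_iff_dvd_of_dvd_sub (one_sub_addChar_one_sq_dvd_sum_sub hp hψ g _ ?_)).mpr hsq
      rw [← hu, mul_sum, mul_sum, ← sum_add_distrib]
      exact sum_congr rfl fun v _ => by ring
    · rw [pow_one]
      exact (dvd_iff_dvd_of_dvd_sub (one_sub_addChar_one_dvd_sum_sub ψ g _)).mpr
        ((one_sub_addChar_one_dvd_prime hψ).trans hgR)
  have hcount := pred_card_mul_le_sum_ite a b
  rw [ZMod.card] at hcount
  rw [Fintype.prod_eq_mul_prod_compl 0, show p + 3 = 1 + (p + 2) by ring, pow_add, pow_one]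
  refine mul_dvd_mul (by simpa using hgR) ?_
  calc (p : R) ^ (p + 2) ∣ ((1 - ψ 1) ^ (p - 1)) ^ (p + 2) :=
        pow_dvd_pow_of_dvd (associated_natCast_prime hψ).dvd _
    _ = (1 - ψ 1) ^ ((p - 1) * (p + 2)) := (pow_mul _ _ _).symm
    _ ∣ _ := pow_dvd_pow _ hcount
    _ = _ := (prod_pow_eq_pow_sum _ _ _).symm
    _ ∣ _ := prod_dvd_prod_of_dvd _ _ fun u _ => hfactor u

end LinearCharacters

section Divisibility

variable {p : ℕ} [Fact p.Prime]

theorem sq_add_three_eq (n : ℕ) : n ^ 2 + 3 = (n + 3) + n * (n - 1) := by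
  cases n with
  | zero => rfl
  | succ n =>
    rw [Nat.add_sub_cancel]
    ring

theorem isPGroup_multiplicative_zmod : IsPGroup p (Multiplicative (ZMod p)) :=
  IsPGroup.of_card (n := 1) (by simp)

theorem odd_card_zmod (hp : 3 ≤ p) : Odd (Fintype.card (ZMod p)) := by
  rw [ZMod.card]
  exact (Fact.out : p.Prime).odd_of_ne_two (by omega)

variable {R : Type*} [CommRing R] [IsDomain R] {ψ : AddChar (ZMod p) R}
  [DecidableEq (heisenbergGroup (ZMod p))]

theorem prime_dvd_sum_coeff_of_dvd_groupDet (hp : 3 ≤ p) (hπ : Prime (1 - ψ 1))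
    {F : MonoidAlgebra ℤ (heisenbergGroup (ZMod p))} (hF : (p : ℤ) ∣ groupDet F) :
    (p : ℤ) ∣ ∑ g, F.coeff g := by
  have hψ := isPrimitive_of_prime_one_sub hπ
  have hπp := one_sub_addChar_one_dvd_prime hψ
  have hdet : 1 - ψ 1 ∣ ∏ u, (inducedMatrix ψ u F).det := by
    rw [← cast_groupDet_eq_prod hψ]
    exact hπp.trans (by simpa using Int.cast_dvd_cast (α := R) _ _ hF)
  obtain ⟨u, -, hu⟩ := hπ.exists_mem_finset_dvd hdet
  refine prime_dvd_of_one_sub_addChar_dvd_intCast hπ ((dvd_iff_dvd_of_dvd_sub ?_).mp hu)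
  exact hπp.trans
    (prime_dvd_det_inducedMatrix_sub isPGroup_multiplicative_zmod (odd_card_zmod hp) ψ u F)

theorem prime_pow_dvd_groupDet_of_dvd_sum_coeff (hp : 3 ≤ p) (hψ : ψ.IsPrimitive)
    {F : MonoidAlgebra ℤ (heisenbergGroup (ZMod p))} (hF : (p : ℤ) ∣ ∑ g, F.coeff g) :
    (p : R) ^ (p ^ 2 + 3) ∣ (groupDet F : R) := by
  have hinduced : ∀ u, (p : R) ∣ (inducedMatrix ψ u F).det := fun u =>
    (dvd_iff_dvd_of_dvd_sub (prime_dvd_det_inducedMatrix_sub isPGroup_multiplicative_zmod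
      (odd_card_zmod hp) ψ u F)).mpr (by simpa using Int.cast_dvd_cast (α := R) _ _ hF)
  rw [cast_groupDet_eq_prod hψ, Fintype.prod_prod_type_right, Fintype.prod_eq_mul_prod_compl 0,
    sq_add_three_eq, pow_add]
  refine mul_dvd_mul ?_ ?_
  · simp only [det_inducedMatrix_snd_zero hψ]
    rw [← Fintype.prod_prod_type']
    exact prime_pow_dvd_prod_sum_addChar hp hψ _ (by rwa [sum_abelianCoeff])
  · rw [pow_mul, ← card_compl_zero_zmod, ← prod_const]
    refine prod_dvd_prod_of_dvd _ _ fun k _ => ?_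
    calc (p : R) ^ p = ∏ _s : ZMod p, (p : R) := by rw [prod_const, card_univ, ZMod.card]
      _ ∣ _ := prod_dvd_prod_of_dvd _ _ fun s _ => hinduced (s, k)

end Divisibility

section ShiftSubDiagonal

variable {n : ℕ} [NeZero n]

theorem perm_zmod_eq_one_or_addRight_one {σ : Equiv.Perm (ZMod n)}
    (hσ : ∀ i, σ i = i ∨ σ i = i + 1) : σ = 1 ∨ σ = Equiv.addRight 1 := by
  by_cases hmoved : ∃ i, σ i = i + 1
  · right
    obtain ⟨i, hi⟩ := hmoved
    have hprop : ∀ k : ℕ, σ (i + k) = i + k + 1 := by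
      intro k
      induction k with
      | zero => simpa using hi
      | succ k ih =>
        push_cast
        rw [← add_assoc]
        rcases hσ (i + k + 1) with h | h
        · exact h.trans (congrArg (· + 1) (σ.injective (h.trans ih.symm))).symm
        · exact h
    ext j
    simpa using hprop (j - i).val
  · left
    push Not at hmoved
    ext i
    exact (hσ i).resolve_right (hmoved i)

theorem det_shift_sub_diagonal {R : Type*} [CommRing R] [Nontrivial (ZMod n)] (hn : Odd n)
    (d : ZMod n → R) :
    (of fun i j : ZMod n => (if i - j = 1 then 1 else 0) - if i - j = 0 then d j else 0).det =
      1 - ∏ j, d j := by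
  have hne : (1 : Equiv.Perm (ZMod n)) ≠ Equiv.addRight 1 := fun h => by
    simpa using DFunLike.congr_fun h 0
  have hsign : Equiv.Perm.sign (Equiv.addRight (1 : ZMod n)) = 1 :=
    sign_addRight_eq_one_of_odd_card (by rwa [ZMod.card]) 1
  rw [det_apply', ← sum_subset (subset_univ {1, Equiv.addRight 1}), sum_pair hne]
  · simp only [Equiv.Perm.sign_one, hsign, Units.val_one, Int.cast_one, of_apply,
      Equiv.Perm.one_apply, Equiv.coe_addRight, sub_self, add_sub_cancel_left, one_ne_zero,
      zero_ne_one, if_true, if_false, zero_sub, sub_zero, prod_neg, card_univ, ZMod.card,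
      hn.neg_one_pow, prod_const_one]
    ring
  · intro σ _ hσ
    obtain ⟨i, hi⟩ : ∃ i, ¬ (σ i = i ∨ σ i = i + 1) := by
      by_contra! h
      exact hσ (by simpa using perm_zmod_eq_one_or_addRight_one h)
    refine mul_eq_zero_of_right _ (prod_eq_zero (mem_univ i) ?_)
    rw [of_apply, if_neg fun h => hi (.inr (by rw [← h, add_sub_cancel])),
      if_neg fun h => hi (.inl (sub_eq_zero.mp h)), sub_zero]

end ShiftSubDiagonal

section Witness

open heisenbergGroup

/-- The element `y - ∑ a, γ a * x ^ a` of the integral group ring of the Heisenberg group, where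
`x = mk 1 0 0` and `y = mk 0 1 0`. -/
noncomputable def heisenbergGroup.ySubSum {A : Type*} [CommRing A] [Fintype A] (γ : A → ℤ) :
    MonoidAlgebra ℤ (heisenbergGroup A) :=
  .single (mk 0 1 0) 1 - ∑ a, .single (mk a 0 0) (γ a)

/-- The Fourier coefficient at `s` of the integer-valued function `γ`, with respect to `ψ`. -/
def charSum {A R : Type*} [CommRing A] [Fintype A] [CommRing R] (ψ : AddChar A R) (γ : A → ℤ)
    (s : A) : R :=
  ∑ a, (γ a : R) * ψ (s * a)

theorem coeff_ySubSum {A : Type*} [CommRing A] [Fintype A] [DecidableEq A] (γ : A → ℤ)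
    (a b c : A) :
    (ySubSum γ).coeff (mk a b c) =
      if c = 0 then (if b = 1 then if a = 0 then 1 else 0 else 0) - if b = 0 then γ a else 0
      else 0 := by
  classical
  simp only [ySubSum, MonoidAlgebra.coeff_sub, MonoidAlgebra.coeff_sum,
    MonoidAlgebra.coeff_single, Finsupp.single_apply, Finsupp.sub_apply, Finsupp.finsetSum_apply,
    mk_inj, ite_and, sum_ite_eq', mem_univ, if_true, eq_comm (a := (0 : A)), eq_comm (a := (1 : A))]
  by_cases hc : c = 0 <;> by_cases ha : a = 0 <;> simp [hc, ha]

theorem inducedMatrix_ySubSum {A R : Type*} [CommRing A] [Fintype A] [DecidableEq A] [CommRing R]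
    (ψ : AddChar A R) (u : A × A) (γ : A → ℤ) :
    inducedMatrix ψ u (ySubSum γ) = of fun i j => (if i - j = 1 then 1 else 0) -
      if i - j = 0 then charSum ψ γ (u.1 + u.2 * j) else 0 := by
  ext i j
  have hcoeff : ∀ a, ∑ c, ((ySubSum γ).coeff (mk a (i - j) c) : R) *
      ψ (u.1 * a + u.2 * (c + a * j)) =
      (if i - j = 1 then if a = 0 then 1 else 0 else 0) -
        if i - j = 0 then (γ a : R) * ψ ((u.1 + u.2 * j) * a) else 0 := by
    intro a
    have hexp : u.1 * a + u.2 * (0 + a * j) = (u.1 + u.2 * j) * a := by ring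
    simp only [coeff_ySubSum]
    rw [sum_eq_single 0 (by intro c _ hc; simp [hc]) (by simp), if_pos rfl, hexp]
    rcases eq_or_ne a 0 with rfl | ha
    · simp
    · simp [ha]
  simp only [inducedMatrix, of_apply, hcoeff, sum_sub_distrib, charSum]
  congr 1 <;> split_ifs <;> simp

variable {p : ℕ} [Fact p.Prime] {R : Type*} [CommRing R] {ψ : AddChar (ZMod p) R}

theorem cast_groupDet_ySubSum [IsDomain R] [DecidableEq (heisenbergGroup (ZMod p))] (hp : 3 ≤ p)
    (hψ : ψ.IsPrimitive) (γ : ZMod p → ℤ) :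
    (groupDet (ySubSum γ) : R) =
      (∏ s, (1 - charSum ψ γ s ^ p)) * (1 - ∏ s, charSum ψ γ s) ^ (p * (p - 1)) := by
  have hdet : ∀ s k, (inducedMatrix ψ (s, k) (ySubSum γ)).det =
      1 - ∏ j, charSum ψ γ (s + k * j) := fun s k => by
    rw [inducedMatrix_ySubSum, det_shift_sub_diagonal (by simpa using odd_card_zmod hp)]
  have hshift : ∀ s k : ZMod p, k ≠ 0 →
      ∏ j, charSum ψ γ (s + k * j) = ∏ j, charSum ψ γ j := fun s k hk =>
    ((Equiv.mulLeft₀ k hk).trans (Equiv.addLeft s)).prod_comp (charSum ψ γ)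
  rw [cast_groupDet_eq_prod hψ, Fintype.prod_prod_type_right, Fintype.prod_eq_mul_prod_compl 0]
  simp only [hdet]
  congr 1
  · simp [ZMod.card]
  · rw [pow_mul, ← card_compl_zero_zmod]
    refine prod_eq_pow_card fun k hk => ?_
    simp [hshift _ k (by simpa using hk), ZMod.card]

/-- The coefficients of `1 + (1 - x) ^ 2 + k * ∑ a, x ^ a`, where `x` generates a group of
order `p`. The parameter `k` only affects the trivial character, and is used to keep
`1 - ∏ s, charSum ψ (witnessCoeff p k) s` from being divisible by `p ^ 2`. -/
def witnessCoeff (p : ℕ) (k : ℤ) (a : ZMod p) : ℤ :=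
  k + ((if a = 0 then 2 else 0) - (if a = 1 then 2 else 0) + if a = 2 then 1 else 0)

theorem charSum_witnessCoeff (ψ : AddChar (ZMod p) R) (k : ℤ) (s : ZMod p) :
    charSum ψ (witnessCoeff p k) s = k * ∑ a, ψ (s * a) + (1 + (1 - ψ s) ^ 2) := by
  have htwo : ψ (s * 2) = ψ s ^ 2 := by rw [mul_two, AddChar.map_add_eq_mul, sq]
  simp only [charSum, witnessCoeff, Int.cast_add, Int.cast_sub, Int.cast_ite, Int.cast_ofNat,
    Int.cast_zero, Int.cast_one, add_mul, sub_mul, ite_mul, zero_mul, sum_add_distrib,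
    sum_sub_distrib, sum_ite_eq', mem_univ, if_true, ← mul_sum, mul_zero, mul_one,
    AddChar.map_zero_eq_one, htwo]
  ring

theorem charSum_witnessCoeff_zero (ψ : AddChar (ZMod p) R) (k : ℤ) :
    charSum ψ (witnessCoeff p k) 0 = 1 + p * k := by
  simp only [charSum_witnessCoeff, zero_mul, AddChar.map_zero_eq_one, sum_const, card_univ,
    ZMod.card, nsmul_eq_mul]
  ring

theorem charSum_witnessCoeff_of_ne_zero [IsDomain R] (hψ : ψ.IsPrimitive) (k : ℤ) {s : ZMod p}
    (hs : s ≠ 0) : charSum ψ (witnessCoeff p k) s = 1 + (1 - ψ s) ^ 2 := by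
  have hsum : ∑ a, ψ (s * a) = 0 := AddChar.sum_eq_zero_of_ne_one (hψ hs)
  rw [charSum_witnessCoeff, hsum, mul_zero, zero_add]

theorem exists_prod_charSum_witnessCoeff_eq [IsDomain R] (hπ : Prime (1 - ψ 1)) :
    ∃ N : ℤ, (p : ℤ) ∣ N - 1 ∧
      ∀ k, ∏ s, charSum ψ (witnessCoeff p k) s = (1 + p * k) * N := by
  have hψ := isPrimitive_of_prime_one_sub hπ
  have hcirculant : (((circulant (witnessCoeff p 0)).det : ℤ) : R) =
      ∏ s, charSum ψ (witnessCoeff p 0) s := by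
    rw [Int.cast_det]
    exact det_circulant_eq_prod (AddChar.to_mulShift_inj_of_isPrimitive hψ)
      fun a => (witnessCoeff p 0 a : R)
  have hcompl : ∏ s ∈ {0}ᶜ, (1 + (1 - ψ s) ^ 2) =
      (((circulant (witnessCoeff p 0)).det : ℤ) : R) := by
    rw [hcirculant, Fintype.prod_eq_mul_prod_compl 0, charSum_witnessCoeff_zero, Int.cast_zero,
      mul_zero, add_zero, one_mul]
    exact prod_congr rfl fun s hs =>
      (charSum_witnessCoeff_of_ne_zero hψ 0 (by simpa using hs)).symm
  refine ⟨(circulant (witnessCoeff p 0)).det, ?_, fun k => ?_⟩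
  · refine prime_dvd_of_one_sub_addChar_dvd_intCast hπ ?_
    rw [Int.cast_sub, Int.cast_one, ← hcompl]
    refine prod_induction _ (1 - ψ 1 ∣ · - 1) (fun x y hx hy => ?_) (by simp) fun s _ => ?_
    · rw [show x * y - 1 = x * (y - 1) + (x - 1) by ring]
      exact dvd_add (hy.mul_left x) hx
    · rw [add_sub_cancel_left, sq]
      exact (one_sub_addChar_one_dvd ψ s).mul_right _
  · rw [← hcompl, Fintype.prod_eq_mul_prod_compl 0, charSum_witnessCoeff_zero]
    congr 1
    exact prod_congr rfl fun s hs => charSum_witnessCoeff_of_ne_zero hψ k (by simpa using hs)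

theorem exists_one_sub_one_add_mul_mul_eq (hp : 3 ≤ p) {N : ℤ} (hN : (p : ℤ) ∣ N - 1) :
    ∃ k m : ℤ, ¬ (p : ℤ) ∣ k ∧ ¬ (p : ℤ) ∣ m ∧ 1 - (1 + p * k) * N = p * m := by
  obtain ⟨M, hM⟩ := hN
  obtain rfl : N = 1 + p * M := by linear_combination hM
  have hone : ¬ (p : ℤ) ∣ 1 := (Nat.prime_iff_prime_int.mp Fact.out).not_dvd_one
  have htwo : ¬ (p : ℤ) ∣ 2 := fun h => by
    have := Int.le_of_dvd two_pos h
    omega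
  have hdvd : ∀ k, (p : ℤ) ∣ -(M + k + p * (k * M)) ↔ (p : ℤ) ∣ M + k := fun k => by
    rw [dvd_neg, dvd_add_left (Dvd.intro _ rfl)]
  suffices ∃ k : ℤ, ¬ (p : ℤ) ∣ k ∧ ¬ (p : ℤ) ∣ M + k by
    obtain ⟨k, hk, hMk⟩ := this
    exact ⟨k, _, hk, mt (hdvd k).mp hMk, by ring⟩
  by_cases h : (p : ℤ) ∣ M + 1
  · exact ⟨2, htwo, fun h' => hone (by simpa using dvd_sub h' h)⟩
  · exact ⟨1, hone, h⟩

theorem exists_one_sub_one_add_pow_eq {π x : R} (hπ : π ∣ (p : R)) (hx : π ∣ x)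
    (hxp : (p : R) ^ 2 ∣ x ^ (p - 1)) : ∃ v, 1 - (1 + x) ^ p = p * x * v ∧ π ∣ v + 1 := by
  have hpp : p.Prime := Fact.out
  obtain ⟨z, hz⟩ := hxp
  have hxpow : x ^ p = x * (p ^ 2 * z) := by rw [← hz, mul_pow_sub_one hpp.ne_zero]
  have hbinom := add_pow_prime_eq hpp x 1
  simp only [one_pow, mul_one] at hbinom
  set S : R := ∑ k ∈ Ioo 0 p, x ^ (k - 1) * ((p.choose k / p : ℕ) : R) with hS
  have hSone : π ∣ S - 1 := by
    rw [hS, ← add_sum_erase _ _ (mem_Ioo.mpr ⟨one_pos, hpp.one_lt⟩), tsub_self, pow_zero,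
      Nat.choose_one_right, Nat.div_self hpp.pos, Nat.cast_one, one_mul, add_sub_cancel_left]
    refine dvd_sum fun k hk => (hx.trans (dvd_pow_self x ?_)).mul_right _
    have := mem_Ioo.mp (mem_of_mem_erase hk)
    have := ne_of_mem_erase hk
    omega
  refine ⟨-(S + p * z), ?_, ?_⟩
  · rw [add_comm 1 x, hbinom, hxpow]
    ring
  · rw [show -(S + p * z) + 1 = -((S - 1) + p * z) by ring, dvd_neg]
    exact dvd_add hSone (hπ.mul_right z)

theorem dvd_and_prime_sq_dvd_charSum_witnessCoeff_sub_one [IsDomain R] (hp : 3 ≤ p)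
    (hψ : ψ.IsPrimitive) (k : ℤ) (s : ZMod p) :
    1 - ψ 1 ∣ charSum ψ (witnessCoeff p k) s - 1 ∧
      (p : R) ^ 2 ∣ (charSum ψ (witnessCoeff p k) s - 1) ^ (p - 1) := by
  rcases eq_or_ne s 0 with rfl | hs
  · rw [charSum_witnessCoeff_zero, add_sub_cancel_left]
    refine ⟨(one_sub_addChar_one_dvd_prime hψ).mul_right _, ?_⟩
    exact (pow_dvd_pow_of_dvd (Dvd.intro _ rfl) 2).trans (pow_dvd_pow _ (by omega))
  · rw [charSum_witnessCoeff_of_ne_zero hψ k hs, add_sub_cancel_left]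
    have hπ := one_sub_addChar_one_dvd ψ s
    refine ⟨hπ.trans (dvd_pow_self _ two_ne_zero), ?_⟩
    rw [pow_right_comm]
    exact pow_dvd_pow_of_dvd
      ((associated_natCast_prime hψ).dvd.trans (pow_dvd_pow_of_dvd hπ _)) 2

theorem exists_prod_one_sub_charSum_pow_eq [IsDomain R] (hp : 3 ≤ p) (hπ : Prime (1 - ψ 1))
    {k : ℤ} (hk : ¬ (p : ℤ) ∣ k) :
    ∃ v, ∏ s, (1 - charSum ψ (witnessCoeff p k) s ^ p) = p ^ (p + 3) * v ∧ ¬ 1 - ψ 1 ∣ v := by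
  have hψ := isPrimitive_of_prime_one_sub hπ
  have hfactor : ∀ s, ∃ v, 1 - charSum ψ (witnessCoeff p k) s ^ p =
      p * (charSum ψ (witnessCoeff p k) s - 1) * v ∧ 1 - ψ 1 ∣ v + 1 := fun s => by
    have h := dvd_and_prime_sq_dvd_charSum_witnessCoeff_sub_one hp hψ k s
    simpa using exists_one_sub_one_add_pow_eq (one_sub_addChar_one_dvd_prime hψ) h.1 h.2
  choose v hv hπv using hfactor
  have hprod : ∏ s, (charSum ψ (witnessCoeff p k) s - 1) = p ^ 3 * k := by
    rw [Fintype.prod_eq_mul_prod_compl 0, charSum_witnessCoeff_zero, prod_congr rfl fun s hs => by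
      rw [charSum_witnessCoeff_of_ne_zero hψ k (by simpa using hs), add_sub_cancel_left],
      prod_pow, prod_one_sub_addChar hψ]
    ring
  refine ⟨k * ∏ s, v s, ?_, fun h => ?_⟩
  · simp only [hv, prod_mul_distrib, hprod, prod_const, card_univ, ZMod.card]
    ring
  · rcases hπ.dvd_or_dvd h with h | h
    · exact hk (prime_dvd_of_one_sub_addChar_dvd_intCast hπ h)
    · obtain ⟨s, -, hs⟩ := hπ.exists_mem_finset_dvd h
      exact hπ.not_dvd_one ((dvd_add_right hs).mp (hπv s))

theorem exists_cast_groupDet_eq_prime_pow_mul [IsDomain R]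
    [DecidableEq (heisenbergGroup (ZMod p))] (hp : 3 ≤ p) (hπ : Prime (1 - ψ 1)) :
    ∃ (F : MonoidAlgebra ℤ (heisenbergGroup (ZMod p))) (v : R),
      (groupDet F : R) = p ^ (p ^ 2 + 3) * v ∧ ¬ 1 - ψ 1 ∣ v := by
  obtain ⟨N, hN, hprod⟩ := exists_prod_charSum_witnessCoeff_eq hπ
  obtain ⟨k, m, hk, hm, hkm⟩ := exists_one_sub_one_add_mul_mul_eq hp hN
  obtain ⟨v, hv, hπv⟩ := exists_prod_one_sub_charSum_pow_eq hp hπ hk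
  have hkmR : (1 - (1 + p * k) * N : R) = p * m := by
    exact_mod_cast congrArg (Int.cast (R := R)) hkm
  refine ⟨ySubSum (witnessCoeff p k), v * m ^ (p * (p - 1)), ?_, fun h => ?_⟩
  · rw [cast_groupDet_ySubSum hp (isPrimitive_of_prime_one_sub hπ), hv, hprod, hkmR,
      sq_add_three_eq, pow_add, mul_pow]
    ring
  · rcases hπ.dvd_or_dvd h with h | h
    · exact hπv h
    · exact hm (prime_dvd_of_one_sub_addChar_dvd_intCast hπ (hπ.dvd_of_dvd_pow h))

end Witness

theorem exists_addChar_ringOfIntegers_prime_one_sub (p : ℕ) [Fact p.Prime] :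
    ∃ ψ : AddChar (ZMod p) (NumberField.RingOfIntegers (CyclotomicField p ℚ)),
      Prime (1 - ψ 1) := by
  have : NeZero p := ⟨(Fact.out : p.Prime).ne_zero⟩
  have : IsCyclotomicExtension {p} ℚ (CyclotomicField p ℚ) :=
    CyclotomicField.isCyclotomicExtension p ℚ
  have hζ := IsCyclotomicExtension.zeta_spec p ℚ (CyclotomicField p ℚ)
  refine ⟨AddChar.zmodChar p hζ.toInteger_isPrimitiveRoot.pow_eq_one, ?_⟩
  have hone : (1 : ZMod p).val = 1 := ZMod.val_one p
  rw [AddChar.zmodChar_apply, hone, pow_one, ← neg_sub]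
  exact hζ.zeta_sub_one_prime'.neg

theorem theorem3p4 (p : ℕ) [Fact p.Prime] (hp : 3 ≤ p) :
    (∀ F : MonoidAlgebra ℤ (heisenbergGroup (ZMod p)),
      (p : ℤ) ∣ groupDet F → (p : ℤ) ^ (p ^ 2 + 3) ∣ groupDet F) ∧
    ∃ F : MonoidAlgebra ℤ (heisenbergGroup (ZMod p)),
      (p : ℤ) ^ (p ^ 2 + 3) ∣ groupDet F ∧ ¬ (p : ℤ) ^ (p ^ 2 + 4) ∣ groupDet F := by
  obtain ⟨ψ, hπ⟩ := exists_addChar_ringOfIntegers_prime_one_sub p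
  have hψ := isPrimitive_of_prime_one_sub hπ
  refine ⟨fun F hF => prime_pow_dvd_of_natCast_pow_dvd_intCast hπ <|
    prime_pow_dvd_groupDet_of_dvd_sum_coeff hp hψ
      (prime_dvd_sum_coeff_of_dvd_groupDet hp hπ hF), ?_⟩
  obtain ⟨F, v, hF, hv⟩ := exists_cast_groupDet_eq_prime_pow_mul hp hπ
  refine ⟨F, prime_pow_dvd_of_natCast_pow_dvd_intCast hπ (Dvd.intro _ hF.symm), fun h => ?_⟩
  have hp0 : (p : NumberField.RingOfIntegers (CyclotomicField p ℚ)) ≠ 0 :=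
    Nat.cast_ne_zero.mpr (Fact.out : p.Prime).ne_zero
  have hpow : (p : NumberField.RingOfIntegers (CyclotomicField p ℚ)) ^ (p ^ 2 + 3) * p ∣
      p ^ (p ^ 2 + 3) * v := by
    rw [← pow_succ, ← hF]
    exact_mod_cast Int.cast_dvd_cast _ _ h
  exact hv ((one_sub_addChar_one_dvd_prime hψ).trans
    ((mul_dvd_mul_iff_left (pow_ne_zero _ hp0)).mp hpow))
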